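/- A labeled graph $(G,L,f)$ consists of a finite simple undirected graph $G$, a finite set $L$ of labels, and a function $f:V(G)\to 2^L$. For $S\subseteq V(G)$ and $t\in V(G)$ let $R(t,S)$ be the set of vertices of $V(G)\setminus S$ reachable from $t$ in $G-S$ (so $R(t,S)=\emptyset$ if $t\in S$), and let $\mathcal L(t,S)=\bigcup_{v\in R(t,S)}f(v)$. For a sequence $T=(t_1,\dots,t_n)$ of distinct vertices (terminals), the cut characteristic of $S$ is the vector $\mathcal K(S,T)=(\mathcal L(t_1,S),\dots,\mathcal L(t_n,S))$, and for an integer $m\ge 1$ let $\mathcal K^m(T)=\{\mathcal K(S,T) : S\subseteq V(G),\ |S|\le m\}$. Theorem. (1) For every labeled graph $(G,L,f)$, every sequence $T$ of $n$ distinct terminals and every $m\ge 1$, $$|\mathcal K^m(T)|\le\Big(4^m\sum_{j=0}^{m'}\binom{|L|}{j}\Big)^n,\qquad m'=\sum_{i=1}^m(i+1)=\frac{m(m+3)}2 .$$ (2) For $m\ge1$, let $\kappa(n,m,r)$ be the maximum of $|\mathcal K^m(T)|$ over all labeled graphs $(G,L,f)$ with $|L|\le r$ and all sequences $T$ of $n$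 distinct terminals in $G$. This maximum exists, and $\kappa(n,m,r)\in O\big(m^{2n}\cdot r^{nm(m+3)/2}\cdot 4^{nm}\big)$; that is, there is an absolute constant $C$ such that for all integers $n\ge0$, $m\ge1$, $r\ge1$, $$\kappa(n,m,r)\le C\, m^{2n}\, r^{nm(m+3)/2}\,4^{nm}.$$ In particular, for fixed $n$ and $m\ge1$, $\kappa(n,m,r)$ is bounded by a polynomial in $r$. -/

import Mathlib

universe u v

/-- A labeled graph on the vertex type `V` with label set `L`: a simple undirected graph together
with a function assigning to each vertex a (possibly empty) set of labels. Finiteness of `V` and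
`L` is imposed wherever labeled graphs are quantified over. -/
structure LabeledGraph (V : Type u) (L : Type v) where
  /-- the underlying simple graph -/
  graph : SimpleGraph V
  /-- the set of labels carried by each vertex -/
  label : V → Set L

namespace LabeledGraph

/-- `R(t, S)`: the vertices outside `S` that are reachable from `t` in `G - S`, the subgraph
induced on the complement of `S`. It is empty if `t ∈ S`. -/
def reachableVertices {V : Type u} {L : Type v} (G : LabeledGraph V L) (t : V) (S : Set V) :
    Set V :=
  {w | ∃ (ht : t ∈ Sᶜ) (hw : w ∈ Sᶜ), (G.graph.induce Sᶜ).Reachable ⟨t, ht⟩ ⟨w, hw⟩}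

/-- The labels reachable from `t` in `G - S`. -/
def reachableLabels {V : Type u} {L : Type v} (G : LabeledGraph V L) (t : V) (S : Set V) :
    Set L :=
  ⋃ w ∈ G.reachableVertices t S, G.label w

/-- The cut characteristic of `S` with respect to the sequence `T` of distinct terminals. -/
def cutCharacteristic {V : Type u} {L : Type v} (G : LabeledGraph V L) {n : ℕ} (T : Fin n ↪ V)
    (S : Set V) : Fin n → Set L :=
  fun i => G.reachableLabels (T i) S

/-- The set of distinct cut characteristics of vertex sets of size at most `m`. -/
def cutCharacteristics {V : Type u} {L : Type v} (G : LabeledGraph V L) {n : ℕ} (m : ℕ)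
    (T : Fin n ↪ V) : Set (Fin n → Set L) :=
  {K | ∃ S : Finset V, S.card ≤ m ∧ K = G.cutCharacteristic T (S : Set V)}

end LabeledGraph

/-- The possible numbers of distinct cut characteristics, for vertex sets of size at most `m`, of
finite labeled graphs with `n` distinct terminals and at most `r` labels. Every finite labeled
graph is isomorphic to one with vertices and labels in `Type`. -/
def cutCharacteristicCounts (n m r : ℕ) : Set ℕ :=
  {k | ∃ (V : Type) (L : Type) (_ : Finite V) (_ : Finite L) (G : LabeledGraph V L)
      (T : Fin n ↪ V), Nat.card L ≤ r ∧ k = (G.cutCharacteristics m T).ncard}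

/-- `κ(n, m, r)`: the maximum number of distinct cut characteristics. -/
noncomputable def cutCharacteristicMax (n m r : ℕ) : ℕ :=
  sSup (cutCharacteristicCounts n m r)

/-!
Deleting `S` from the graph leaves a region `R = R(t, S)` around the terminal whose boundary lies
in `S`. Recording `R` instead of `S` makes the boundary `∂R = Φ R \ R` the basic object, where
`Φ R` consists of `t` and all neighbours of `R`. The only property of `Φ` that matters is that it
preserves binary unions, which makes `R ↦ |∂R|` submodular (`card_boundary_submodular`). Including
`t` in `Φ R` treats the case `t ∈ S` on the same footing: then `R = ∅` and `∂R = {t}`.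

A cut characteristic is a vector whose entries are cut characteristics for single terminals, so the
case of one terminal suffices. Given a value `A` of the reachable labels, choose `R` realizing it
with the smallest boundary, say of size `k`, and, subject to this, `R` as large as possible. A
region containing `R` and carrying no label outside `A` then has a boundary of size at least `k`,
and of size more than `k` if it contains a vertex of `∂R` (`exists_important_region`). Submodularity
shows that few labels outside `A` witness this (`exists_witness_labels`): whenever the lower bound
on the boundary of the regions that avoid the current witnesses is to be raised by one, the smallest
region attaining it is contained in all others attaining it, so a single label of that region
suffices. This takes `k` labels to reach the bound `k`, and one more for each of the `k` vertices of
`∂R`. Hence `R` is an important region with respect to a set `Q` of at most `2 m ≤ m (m + 3) / 2`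
labels, that is, `∂R` is an important separator between `t` and the vertices carrying a label of
`Q`.

For fixed `Q` there are at most `4 ^ m` important separators of size at most `m`
(`ncard_importantBoundaries_le`), by the usual branching on a vertex of the boundary of the largest
minimum region: it is either deleted, or added to the base of the regions. As `∂R` determines the
connected region `R`, the pair `(Q, ∂R)` determines `A`.
-/

section Boundary

variable {V : Type*} [DecidableEq V]

/-! ### Submodularity of the boundary -/

/-- The boundary of `R` for an expansion operator `Φ`. For `Φ R` the set of neighbours of `R`, this
is the vertex boundary. -/
def boundary (Φ : Finset V → Finset V) (R : Finset V) : Finset V := Φ R \ R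

/-- `R` is connected over the base `B`: a set between `B` and `R` that has no boundary vertex
in `R` is all of `R`, so that `R` is exhausted by expanding `B` inside `R`. -/
def ConnectedOver (Φ : Finset V → Finset V) (B R : Finset V) : Prop :=
  ∀ U, B ⊆ U → U ⊆ R → Disjoint (boundary Φ U) R → U = R

/-- `R` is important with respect to the set `X` it has to avoid: a region containing `R` and
avoiding `X` whose boundary is no larger contains no vertex of the boundary of `R`. -/
def IsImportant (Φ : Finset V → Finset V) (X R : Finset V) : Prop :=
  ∀ R', R ⊆ R' → Disjoint R' X → (boundary Φ R').card ≤ (boundary Φ R).card →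
    Disjoint R' (boundary Φ R)

/-- The boundaries of size at most `k` of the important regions that avoid `X` and are connected
over `B`. -/
def importantBoundaries (Φ : Finset V → Finset V) (B X : Finset V) (k : ℕ) :
    Set (Finset V) :=
  {S | ∃ R, B ⊆ R ∧ Disjoint R X ∧ ConnectedOver Φ B R ∧ IsImportant Φ X R ∧
    (boundary Φ R).card ≤ k ∧ boundary Φ R = S}

variable {Φ : Finset V → Finset V}

theorem expansion_mono (hΦ : ∀ A B, Φ (A ∪ B) = Φ A ∪ Φ B) {A B : Finset V} (h : A ⊆ B) :
    Φ A ⊆ Φ B := by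
  have := hΦ A B
  rw [Finset.union_eq_right.2 h] at this
  rw [this]
  exact Finset.subset_union_left

theorem card_boundary_submodular (hΦ : ∀ A B, Φ (A ∪ B) = Φ A ∪ Φ B) (A B : Finset V) :
    (boundary Φ (A ∪ B)).card + (boundary Φ (A ∩ B)).card ≤
      (boundary Φ A).card + (boundary Φ B).card := by
  -- `|∂R| = |Φ R ∪ R| - |R|`, where the subtracted term is modular and the first one submodular.
  have key : ∀ R, (boundary Φ R).card + R.card = (Φ R ∪ R).card := fun R => by
    rw [boundary, ← Finset.sdiff_union_self_eq_union,
      Finset.card_union_of_disjoint Finset.sdiff_disjoint]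
  have h1 := key A
  have h2 := key B
  have h3 := key (A ∪ B)
  have h4 := key (A ∩ B)
  have h5 := Finset.card_union_add_card_inter A B
  have h6 := Finset.card_union_add_card_inter (Φ A ∪ A) (Φ B ∪ B)
  have h7 : (Φ (A ∪ B) ∪ (A ∪ B)).card = ((Φ A ∪ A) ∪ (Φ B ∪ B)).card := by
    rw [hΦ]
    congr 1
    ext x
    simp only [Finset.mem_union]
    tauto
  have h8 : (Φ (A ∩ B) ∪ (A ∩ B)).card ≤ ((Φ A ∪ A) ∩ (Φ B ∪ B)).card := by
    apply Finset.card_le_card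
    exact Finset.subset_inter
      (Finset.union_subset_union (expansion_mono hΦ Finset.inter_subset_left)
        Finset.inter_subset_left)
      (Finset.union_subset_union (expansion_mono hΦ Finset.inter_subset_right)
        Finset.inter_subset_right)
  omega

theorem boundary_subset_of_disjoint (hΦ : ∀ A B, Φ (A ∪ B) = Φ A ∪ Φ B) {R R' : Finset V}
    (h : R ⊆ R') (hd : Disjoint R' (boundary Φ R)) : boundary Φ R ⊆ boundary Φ R' := by
  intro x hx
  exact Finset.mem_sdiff.2 ⟨expansion_mono hΦ h (Finset.mem_sdiff.1 hx).1,
    fun hx' => Finset.disjoint_left.1 hd hx' hx⟩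

theorem ConnectedOver.union (hΦ : ∀ A B, Φ (A ∪ B) = Φ A ∪ Φ B) {B R B' : Finset V}
    (h : ConnectedOver Φ B R) (hBR : B ⊆ R) (hB : B ⊆ B') : ConnectedOver Φ B' (R ∪ B') := by
  intro U h1 h2 h3
  have hUR : U ∩ R = R := by
    apply h _ (Finset.subset_inter (hB.trans h1) hBR) Finset.inter_subset_right
    rw [Finset.disjoint_left]
    intro x hx hxR
    obtain ⟨hx1, hx2⟩ := Finset.mem_sdiff.1 hx
    refine Finset.disjoint_left.1 h3 (Finset.mem_sdiff.2
      ⟨expansion_mono hΦ Finset.inter_subset_left hx1, fun hxU => ?_⟩)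
      (Finset.mem_union_left _ hxR)
    exact hx2 (Finset.mem_inter.2 ⟨hxU, hxR⟩)
  exact h2.antisymm (Finset.union_subset (Finset.inter_eq_right.1 hUR) h1)

/-- A connected region is determined by its boundary. -/
theorem ConnectedOver.eq_of_boundary_eq (hΦ : ∀ A B, Φ (A ∪ B) = Φ A ∪ Φ B) {R R' : Finset V}
    (h : ConnectedOver Φ ∅ R) (h' : ConnectedOver Φ ∅ R')
    (hb : boundary Φ R = boundary Φ R') : R = R' := by
  have aux : ∀ {R R' : Finset V}, ConnectedOver Φ ∅ R → boundary Φ R = boundary Φ R' →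
      R ∩ R' = R := fun {R R'} h hb => by
    apply h _ (Finset.empty_subset _) Finset.inter_subset_left
    rw [Finset.disjoint_left]
    intro x hx hxR
    obtain ⟨hx1, hx2⟩ := Finset.mem_sdiff.1 hx
    have : x ∈ boundary Φ R := hb ▸ Finset.mem_sdiff.2
      ⟨expansion_mono hΦ Finset.inter_subset_right hx1,
        fun hx' => hx2 (Finset.mem_inter.2 ⟨hxR, hx'⟩)⟩
    exact (Finset.mem_sdiff.1 this).2 hxR
  rw [← aux h hb, Finset.inter_comm, aux h' hb.symm]

/-- The connected component `U` of a region `R'` containing a connected region `R`. -/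
theorem exists_connectedOver_between (hΦ : ∀ A B, Φ (A ∪ B) = Φ A ∪ Φ B) {R R' : Finset V}
    (hR : ConnectedOver Φ ∅ R) (h : R ⊆ R') :
    ∃ U, R ⊆ U ∧ U ⊆ R' ∧ ConnectedOver Φ ∅ U ∧ boundary Φ U ⊆ boundary Φ R' := by
  classical
  have hne : (R'.powerset.filter fun U => Disjoint (boundary Φ U) R').Nonempty :=
    ⟨R', Finset.mem_filter.2 ⟨Finset.mem_powerset_self _, Finset.sdiff_disjoint⟩⟩
  obtain ⟨U, hU, hmin⟩ := Finset.exists_min_image _ Finset.card hne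
  simp only [Finset.mem_filter, Finset.mem_powerset] at hU hmin
  refine ⟨U, ?_, hU.1, ?_, ?_⟩
  · rw [← Finset.inter_eq_right]
    apply hR _ (Finset.empty_subset _) Finset.inter_subset_right
    rw [Finset.disjoint_left]
    intro x hx hxR
    obtain ⟨hx1, hx2⟩ := Finset.mem_sdiff.1 hx
    exact Finset.disjoint_left.1 hU.2 (Finset.mem_sdiff.2
      ⟨expansion_mono hΦ Finset.inter_subset_left hx1,
        fun hxU => hx2 (Finset.mem_inter.2 ⟨hxU, hxR⟩)⟩) (h hxR)
  · intro W _ hWU hW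
    refine Finset.eq_of_subset_of_card_le hWU (hmin W ⟨hWU.trans hU.1, ?_⟩)
    rw [Finset.disjoint_left]
    intro x hx hxR
    by_cases hxU : x ∈ U
    · exact Finset.disjoint_left.1 hW hx hxU
    · exact Finset.disjoint_left.1 hU.2 (Finset.mem_sdiff.2
        ⟨expansion_mono hΦ hWU (Finset.mem_sdiff.1 hx).1, hxU⟩) hxR
  · intro x hx
    exact Finset.mem_sdiff.2 ⟨expansion_mono hΦ hU.1 (Finset.mem_sdiff.1 hx).1,
      fun hxR => Finset.disjoint_left.1 hU.2 hx hxR⟩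

/-! ### Counting important boundaries -/

/-- Enlarging the base by a region of smallest boundary changes neither the boundary of an
important region nor its importance. -/
theorem IsImportant.union_minimum (hΦ : ∀ A B, Φ (A ∪ B) = Φ A ∪ Φ B) {B X M R : Finset V}
    (hBM : B ⊆ M) (hMX : Disjoint M X)
    (hM : ∀ R, B ⊆ R → Disjoint R X → (boundary Φ M).card ≤ (boundary Φ R).card)
    (hBR : B ⊆ R) (hRX : Disjoint R X) (hR : IsImportant Φ X R) :
    boundary Φ (R ∪ M) = boundary Φ R ∧ IsImportant Φ X (R ∪ M) := by
  have hX : Disjoint (R ∪ M) X := Finset.disjoint_union_left.2 ⟨hRX, hMX⟩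
  have hcard : (boundary Φ (R ∪ M)).card ≤ (boundary Φ R).card := by
    have h1 := card_boundary_submodular hΦ R M
    have h2 := hM (R ∩ M) (Finset.subset_inter hBR hBM)
      (hRX.mono_left Finset.inter_subset_left)
    omega
  have hsub := boundary_subset_of_disjoint hΦ Finset.subset_union_left
    (hR _ Finset.subset_union_left hX hcard)
  have heq : boundary Φ (R ∪ M) = boundary Φ R :=
    (Finset.eq_of_subset_of_card_le hsub hcard).symm
  refine ⟨heq, fun R' h1 h2 h3 => ?_⟩
  rw [heq] at h3 ⊢
  exact hR R' (Finset.subset_union_left.trans h1) h2 h3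

/-- The branch in which the vertex `v` belongs to the boundary: `v` is deleted from the graph, and
the remaining budget drops by one. -/
theorem erase_mem_importantBoundaries {B X S : Finset V} {k : ℕ} {v : V} (hvS : v ∈ S)
    (hS : S ∈ importantBoundaries Φ B X (k + 1)) :
    S.erase v ∈ importantBoundaries (fun R => (Φ R).erase v) B (insert v X) k := by
  obtain ⟨R, hBR, hRX, hconn, himp, hk, rfl⟩ := hS
  have hb : ∀ U, boundary (fun R => (Φ R).erase v) U = (boundary Φ U).erase v := fun U => by
    simp only [boundary]
    rw [Finset.erase_sdiff_comm]
  have hvR : v ∉ R := (Finset.mem_sdiff.1 hvS).2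
  refine ⟨R, hBR, ?_, ?_, ?_, ?_, hb R⟩
  · exact Finset.disjoint_insert_right.2 ⟨hvR, hRX⟩
  · intro U h1 h2 h3
    refine hconn U h1 h2 ?_
    rw [hb] at h3
    rw [Finset.disjoint_left] at h3 ⊢
    intro x hx hxR
    exact h3 (Finset.mem_erase.2 ⟨fun h => hvR (h ▸ hxR), hx⟩) hxR
  · intro R' h1 h2 h3
    rw [hb, hb, Finset.card_erase_of_mem hvS] at h3
    rw [hb]
    have h4 := Finset.card_pos.2 ⟨v, hvS⟩
    have h5 := Finset.pred_card_le_card_erase (s := boundary Φ R') (a := v)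
    refine (himp R' h1 (Finset.disjoint_insert_right.1 h2).2 (by omega)).mono_right
      (Finset.erase_subset _ _)
  · rw [hb, Finset.card_erase_of_mem hvS]
    omega

/-- Branching bound for important separators. The measure `2 k - p`, where `p` bounds the boundaries
of all admissible regions from below, drops in both branches. -/
theorem ncard_importantBoundaries_le_two_pow [Fintype V] (n : ℕ) :
    ∀ (Φ : Finset V → Finset V), (∀ A B, Φ (A ∪ B) = Φ A ∪ Φ B) →
      ∀ (B X : Finset V) (k p : ℕ),
      (∀ R, B ⊆ R → Disjoint R X → p ≤ (boundary Φ R).card) → 2 * k ≤ n + p →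
      (importantBoundaries Φ B X k).ncard ≤ 2 ^ n := by
  induction n with
  | zero => ?_
  | succ n ih => ?_
  all_goals
    intro Φ hΦ B X k p hp hkp
    rcases (importantBoundaries Φ B X k).eq_empty_or_nonempty with hF | ⟨S₀, hS₀⟩
    · simp [hF]
    -- `M` is a region of smallest boundary, and maximal as such.
    obtain ⟨M, hBM, hMX, hM, hmax⟩ : ∃ M, B ⊆ M ∧ Disjoint M X ∧
        (∀ R, B ⊆ R → Disjoint R X → (boundary Φ M).card ≤ (boundary Φ R).card) ∧
        (∀ R, M ⊂ R → Disjoint R X → (boundary Φ M).card < (boundary Φ R).card) := by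
      obtain ⟨R₀, h1, h2, -⟩ := hS₀
      have hne : (Finset.univ.filter fun R => B ⊆ R ∧ Disjoint R X).Nonempty :=
        ⟨R₀, by simp [h1, h2]⟩
      obtain ⟨M₀, hM₀, hM₀min⟩ := Finset.exists_min_image _ (fun R => (boundary Φ R).card) hne
      simp only [Finset.mem_filter, Finset.mem_univ, true_and] at hM₀ hM₀min
      have hne' : (Finset.univ.filter fun R => (B ⊆ R ∧ Disjoint R X) ∧
          (boundary Φ R).card = (boundary Φ M₀).card).Nonempty := ⟨M₀, by simp [hM₀]⟩
      obtain ⟨M, hM, hMmax⟩ := Finset.exists_max_image _ Finset.card hne'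
      simp only [Finset.mem_filter, Finset.mem_univ, true_and] at hM hMmax
      refine ⟨M, hM.1.1, hM.1.2, fun R h1 h2 => hM.2 ▸ hM₀min R ⟨h1, h2⟩, fun R h1 h2 => ?_⟩
      have hBR := hM.1.1.trans h1.subset
      rw [hM.2]
      refine lt_of_le_of_ne (hM₀min R ⟨hBR, h2⟩) fun heq => ?_
      exact absurd (hMmax R ⟨⟨hBR, h2⟩, heq.symm⟩) (not_le.2 (Finset.card_lt_card h1))
    have hMk : (boundary Φ M).card ≤ k := by
      obtain ⟨R₀, h1, h2, -, -, h3, -⟩ := hS₀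
      exact (hM R₀ h1 h2).trans h3
    have hpM := hp M hBM hMX
    have hzero : boundary Φ M = ∅ → (importantBoundaries Φ B X k).ncard ≤ 1 := by
      intro h0
      refine (Set.ncard_le_ncard (t := {∅}) ?_).trans (Set.ncard_singleton _).le
      rintro S ⟨R, hBR, hRX, hconn, himp, hk, rfl⟩
      have h1 := (himp.union_minimum hΦ hBM hMX hM hBR hRX).1
      have h2 := hconn.union hΦ hBR hBM M subset_rfl Finset.subset_union_right (by simp [h0])
      rw [← h2, h0] at h1
      exact h1.symm
  · refine hzero (Finset.card_eq_zero.1 (by omega))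
  · rcases (boundary Φ M).eq_empty_or_nonempty with h0 | ⟨v, hv⟩
    · exact (hzero h0).trans Nat.one_le_two_pow
    have hpos := Finset.card_pos.2 ⟨v, hv⟩
    obtain ⟨k, rfl⟩ : ∃ k', k = k' + 1 := ⟨k - 1, by omega⟩
    have hvM := (Finset.mem_sdiff.1 hv).2
    have h1 := ih (fun R => (Φ R).erase v) (fun A B => by
        simp only [hΦ, Finset.erase_union_distrib])
      B (insert v X) k ((boundary Φ M).card - 1) (fun R h1 h2 => by
        have h3 := hM R h1 (Finset.disjoint_insert_right.1 h2).2
        have h4 : boundary (fun R => (Φ R).erase v) R = (boundary Φ R).erase v := by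
          simp only [boundary]
          rw [Finset.erase_sdiff_comm]
        have h5 := Finset.pred_card_le_card_erase (s := boundary Φ R) (a := v)
        rw [h4]
        omega) (by omega)
    have h2 := ih Φ hΦ (insert v M) X (k + 1) ((boundary Φ M).card + 1) (fun R h1 h2 =>
      hmax R ((Finset.ssubset_insert hvM).trans_subset h1) h2) (by omega)
    have hsub : importantBoundaries Φ B X (k + 1) ⊆
        insert v '' importantBoundaries (fun R => (Φ R).erase v) B (insert v X) k ∪
          importantBoundaries Φ (insert v M) X (k + 1) := by
      intro S hS
      by_cases hvS : v ∈ S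
      · exact Or.inl ⟨_, erase_mem_importantBoundaries hvS hS, Finset.insert_erase hvS⟩
      · right
        obtain ⟨R, hBR, hRX, hconn, himp, hk, rfl⟩ := hS
        obtain ⟨h3, h4⟩ := himp.union_minimum hΦ hBM hMX hM hBR hRX
        have hvR : v ∈ R ∪ M := by
          by_contra hvR
          rw [← h3] at hvS
          exact hvS (Finset.mem_sdiff.2 ⟨expansion_mono hΦ Finset.subset_union_right
            (Finset.mem_sdiff.1 hv).1, hvR⟩)
        refine ⟨R ∪ M, Finset.insert_subset hvR Finset.subset_union_right,
          Finset.disjoint_union_left.2 ⟨hRX, hMX⟩, fun U hU => ?_, h4, h3 ▸ hk, h3⟩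
        exact hconn.union hΦ hBR hBM U ((Finset.subset_insert _ _).trans hU)
    calc _ ≤ _ := Set.ncard_le_ncard hsub
      _ ≤ _ := Set.ncard_union_le _ _
      _ ≤ 2 ^ n + 2 ^ n := add_le_add ((Set.ncard_image_le).trans h1) h2
      _ = 2 ^ (n + 1) := by ring

theorem ncard_importantBoundaries_le [Fintype V] (hΦ : ∀ A B, Φ (A ∪ B) = Φ A ∪ Φ B)
    (B X : Finset V) (k : ℕ) : (importantBoundaries Φ B X k).ncard ≤ 4 ^ k := by
  have := ncard_importantBoundaries_le_two_pow (2 * k) Φ hΦ B X k 0 (by simp) le_rfl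
  rwa [pow_mul] at this

/-! ### Few labels witness importance -/

variable {L : Type*} [DecidableEq L] {f : V → Finset L}

/-- If all regions over `P` avoiding the labels `Q` have boundary at least `i`, then one further
label of `C` excludes boundary `i`, provided that `C` as a whole does: the region of boundary `i`
that is smallest is contained in all the others. -/
theorem exists_witness_label [Fintype V] (hΦ : ∀ A B, Φ (A ∪ B) = Φ A ∪ Φ B) {C Q : Finset L}
    {P : Finset V} {i : ℕ} (hQC : Q ⊆ C)
    (hQ : ∀ R, P ⊆ R → Disjoint (R.biUnion f) Q → i ≤ (boundary Φ R).card)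
    (hC : ∀ R, P ⊆ R → Disjoint (R.biUnion f) C → i < (boundary Φ R).card) :
    ∃ Q', Q ⊆ Q' ∧ Q' ⊆ C ∧ Q'.card ≤ Q.card + 1 ∧
      ∀ R, P ⊆ R → Disjoint (R.biUnion f) Q' → i < (boundary Φ R).card := by
  classical
  rcases (Finset.univ.filter fun R => (P ⊆ R ∧ Disjoint (R.biUnion f) Q) ∧
    (boundary Φ R).card = i).eq_empty_or_nonempty with he | hne
  · refine ⟨Q, subset_rfl, hQC, Nat.le_succ _, fun R h1 h2 => ?_⟩
    refine lt_of_le_of_ne (hQ R h1 h2) fun h => ?_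
    have : R ∈ (∅ : Finset (Finset V)) := he ▸ by simp [h1, h2, h]
    simp at this
  obtain ⟨M, hM, hmin⟩ := Finset.exists_min_image _ Finset.card hne
  simp only [Finset.mem_filter, Finset.mem_univ, true_and] at hM hmin
  obtain ⟨⟨hPM, hMQ⟩, hMi⟩ := hM
  have : ¬ Disjoint (M.biUnion f) C := fun h => (hC M hPM h).ne' hMi
  obtain ⟨q, hqM, hqC⟩ := Finset.not_disjoint_iff.1 this
  refine ⟨insert q Q, Finset.subset_insert _ _, Finset.insert_subset hqC hQC,
    Finset.card_insert_le _ _, fun R h1 h2 => ?_⟩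
  obtain ⟨hqR, hRQ⟩ := Finset.disjoint_insert_right.1 h2
  refine lt_of_le_of_ne (hQ R h1 hRQ) fun h => hqR ?_
  have h3 := hQ (R ∪ M) (h1.trans Finset.subset_union_left) (by
    rw [Finset.union_biUnion]
    exact Finset.disjoint_union_left.2 ⟨hRQ, hMQ⟩)
  have h4 : P ⊆ R ∩ M := Finset.subset_inter h1 hPM
  have h5 : Disjoint ((R ∩ M).biUnion f) Q :=
    hRQ.mono_left (Finset.biUnion_subset_biUnion_of_subset_left _ Finset.inter_subset_left)
  have h6 := hQ (R ∩ M) h4 h5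
  have h7 := card_boundary_submodular hΦ R M
  have h8 := hmin (R ∩ M) ⟨⟨h4, h5⟩, by omega⟩
  have h9 := Finset.eq_of_subset_of_card_le Finset.inter_subset_right h8
  exact Finset.biUnion_subset_biUnion_of_subset_left _ (Finset.inter_eq_right.1 h9) hqM

/-- If `R` is important with respect to the vertices carrying a label of `C`, with smallest
boundary, then it is so with respect to at most `2 |∂R|` labels of `C`. -/
theorem exists_witness_labels [Fintype V] (hΦ : ∀ A B, Φ (A ∪ B) = Φ A ∪ Φ B) {C : Finset L}
    {R : Finset V}
    (hmin : ∀ R', R ⊆ R' → Disjoint (R'.biUnion f) C →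
      (boundary Φ R).card ≤ (boundary Φ R').card)
    (himp : ∀ R', R ⊆ R' → Disjoint (R'.biUnion f) C →
      (boundary Φ R').card ≤ (boundary Φ R).card → Disjoint R' (boundary Φ R)) :
    ∃ Q ⊆ C, Q.card ≤ 2 * (boundary Φ R).card ∧
      ∀ R', R ⊆ R' → Disjoint (R'.biUnion f) Q →
        (boundary Φ R').card ≤ (boundary Φ R).card → Disjoint R' (boundary Φ R) := by
  have step1 : ∀ i ≤ (boundary Φ R).card, ∃ Q ⊆ C, Q.card ≤ i ∧
      ∀ R', R ⊆ R' → Disjoint (R'.biUnion f) Q → i ≤ (boundary Φ R').card := by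
    intro i
    induction i with
    | zero => exact fun _ => ⟨∅, Finset.empty_subset _, by simp, by simp⟩
    | succ i ih =>
      intro hi
      obtain ⟨Q, h1, h2, h3⟩ := ih (by omega)
      obtain ⟨Q', -, h4, h5, h6⟩ := exists_witness_label hΦ h1 h3
        fun R' h h' => lt_of_lt_of_le hi (hmin R' h h')
      exact ⟨Q', h4, by omega, h6⟩
  obtain ⟨Q₀, hQ₀C, hQ₀card, hQ₀⟩ := step1 _ le_rfl
  have step2 : ∀ D ⊆ boundary Φ R, ∃ Q, Q₀ ⊆ Q ∧ Q ⊆ C ∧ Q.card ≤ Q₀.card + D.card ∧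
      ∀ s ∈ D, ∀ R', insert s R ⊆ R' → Disjoint (R'.biUnion f) Q →
        (boundary Φ R).card < (boundary Φ R').card := by
    intro D
    induction D using Finset.induction_on with
    | empty => exact fun _ => ⟨Q₀, subset_rfl, hQ₀C, by simp, by simp⟩
    | insert s D hs ih =>
      intro hD
      obtain ⟨hsR, hD⟩ := Finset.insert_subset_iff.1 hD
      obtain ⟨Q, h1, h2, h3, h4⟩ := ih hD
      obtain ⟨Q', h5, h6, h7, h8⟩ := exists_witness_label (P := insert s R)
        (i := (boundary Φ R).card) hΦ h2
        (fun R' h h' => hQ₀ R' ((Finset.subset_insert _ _).trans h) (h'.mono_right h1))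
        (fun R' h h' => by
          obtain ⟨hsR', h⟩ := Finset.insert_subset_iff.1 h
          by_contra hlt
          exact Finset.disjoint_left.1 (himp R' h h' (not_lt.1 hlt)) hsR' hsR)
      refine ⟨Q', h1.trans h5, h6, ?_, ?_⟩
      · rw [Finset.card_insert_of_notMem hs]
        omega
      · intro x hx R' h h'
        rcases Finset.mem_insert.1 hx with rfl | hx
        · exact h8 R' h h'
        · exact h4 x hx R' h (h'.mono_right h5)
  obtain ⟨Q, -, h2, h3, h4⟩ := step2 _ subset_rfl
  refine ⟨Q, h2, by omega, fun R' h5 h6 h7 => ?_⟩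
  rw [Finset.disjoint_left]
  intro s hsR' hs
  exact absurd (h4 s hs R' (Finset.insert_subset hsR' h5) h6) (not_lt.2 h7)

/-- Every label set of a connected region of boundary at most `m` is realized by a region that is
important with respect to the vertices carrying one of at most `2 m` labels. -/
theorem exists_important_region [Fintype V] [Fintype L] (hΦ : ∀ A B, Φ (A ∪ B) = Φ A ∪ Φ B)
    {m : ℕ} {R₀ : Finset V} (hR₀ : ConnectedOver Φ ∅ R₀) (hm : (boundary Φ R₀).card ≤ m) :
    ∃ (Q : Finset L) (R : Finset V), Q.card ≤ 2 * m ∧ R.biUnion f = R₀.biUnion f ∧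
      ConnectedOver Φ ∅ R ∧ boundary Φ R ∈
        importantBoundaries Φ ∅ (Finset.univ.filter fun v => ¬ Disjoint (f v) Q) m := by
  classical
  have hne : (Finset.univ.filter fun R => ConnectedOver Φ ∅ R ∧
      R.biUnion f = R₀.biUnion f).Nonempty := ⟨R₀, by simp [hR₀]⟩
  obtain ⟨R₁, hR₁, hR₁min⟩ := Finset.exists_min_image _ (fun R => (boundary Φ R).card) hne
  have hne' : (Finset.univ.filter fun R => (ConnectedOver Φ ∅ R ∧
      R.biUnion f = R₀.biUnion f) ∧ (boundary Φ R).card = (boundary Φ R₁).card).Nonempty :=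
    ⟨R₁, by simpa using hR₁⟩
  obtain ⟨R, hR, hRmax⟩ := Finset.exists_max_image _ Finset.card hne'
  simp only [Finset.mem_filter, Finset.mem_univ, true_and] at hR₁ hR₁min hR hRmax
  obtain ⟨⟨hRconn, hRlab⟩, hRcard⟩ := hR
  rw [← hRcard] at hR₁min hRmax
  have hRm : (boundary Φ R).card ≤ m := (hR₁min R₀ ⟨hR₀, rfl⟩).trans hm
  -- A larger region that meets no label outside the given set contains a connected one
  -- with the same labels, to which the extremal choice of `R` applies.
  have hext : ∀ R', R ⊆ R' → Disjoint (R'.biUnion f) (R.biUnion f)ᶜ →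
      (boundary Φ R).card ≤ (boundary Φ R').card ∧
      ((boundary Φ R').card ≤ (boundary Φ R).card → Disjoint R' (boundary Φ R)) := by
    intro R' h1 h2
    obtain ⟨U, h3, h4, h5, h6⟩ := exists_connectedOver_between hΦ hRconn h1
    have hlab : U.biUnion f = R₀.biUnion f := by
      rw [← hRlab]
      refine (Finset.Subset.trans (Finset.biUnion_subset_biUnion_of_subset_left _ h4) ?_).antisymm
        (Finset.biUnion_subset_biUnion_of_subset_left _ h3)
      intro l hl
      by_contra hlR
      exact Finset.disjoint_left.1 h2 hl (Finset.mem_compl.2 hlR)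
    have h7 := hR₁min U ⟨h5, hlab⟩
    have h8 := Finset.card_le_card h6
    refine ⟨h7.trans h8, fun h9 => ?_⟩
    have h10 : R = U := Finset.eq_of_subset_of_card_le h3 (hRmax U ⟨⟨h5, hlab⟩, by omega⟩)
    rw [h10]
    exact (Finset.sdiff_disjoint.mono_left h6).symm
  obtain ⟨Q, hQC, hQcard, hQ⟩ := exists_witness_labels (f := f) hΦ
    (fun R' h1 h2 => (hext R' h1 h2).1) (fun R' h1 h2 => (hext R' h1 h2).2)
  have hX : ∀ R' : Finset V, Disjoint R' (Finset.univ.filter fun v => ¬ Disjoint (f v) Q) ↔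
      Disjoint (R'.biUnion f) Q := fun R' => by
    rw [Finset.disjoint_biUnion_left, Finset.disjoint_left]
    simp
  refine ⟨Q, R, by omega, hRlab, hRconn, R, Finset.empty_subset _, ?_, hRconn, ?_, hRm, rfl⟩
  · rw [hX]
    exact disjoint_compl_right.mono_right hQC
  · intro R' h1 h2 h3
    exact hQ R' h1 ((hX R').1 h2) h3

theorem card_powerset_filter_card_le (L : Type*) [Fintype L] [DecidableEq L] (d : ℕ) :
    (Finset.univ.filter fun Q : Finset L => Q.card ≤ d).card =
      ∑ j ∈ Finset.range (d + 1), (Fintype.card L).choose j := by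
  have : (Finset.univ.filter fun Q : Finset L => Q.card ≤ d) =
      (Finset.range (d + 1)).biUnion fun j => Finset.powersetCard j Finset.univ := by
    ext Q
    simp [Finset.mem_powersetCard]
  rw [this, Finset.card_biUnion]
  · simp
  · intro i _ j _ hij
    exact Finset.pairwise_disjoint_powersetCard _ hij

/-- A region is recovered from the pair of its witness labels and its boundary. -/
theorem ncard_labelSets_le [Fintype V] [Fintype L] (hΦ : ∀ A B, Φ (A ∪ B) = Φ A ∪ Φ B) (m d : ℕ)
    (hd : 2 * m ≤ d) :
    {A : Finset L | ∃ R, ConnectedOver Φ ∅ R ∧ (boundary Φ R).card ≤ m ∧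
      R.biUnion f = A}.ncard ≤
      (∑ j ∈ Finset.range (d + 1), (Fintype.card L).choose j) * 4 ^ m := by
  classical
  let F : Finset L → Finset (Finset V) := fun Q =>
    (Set.toFinite (importantBoundaries Φ ∅
      (Finset.univ.filter fun v => ¬ Disjoint (f v) Q) m)).toFinset
  let pairs := (Finset.univ.filter fun Q : Finset L => Q.card ≤ d).sigma F
  have hpairs : pairs.card ≤
      (∑ j ∈ Finset.range (d + 1), (Fintype.card L).choose j) * 4 ^ m := by
    rw [Finset.card_sigma, ← card_powerset_filter_card_le, ← smul_eq_mul]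
    refine Finset.sum_le_card_nsmul _ _ _ fun Q _ => ?_
    rw [← Set.ncard_eq_toFinset_card]
    exact ncard_importantBoundaries_le hΦ _ _ _
  refine le_trans ?_ hpairs
  have hex : ∀ A ∈ {A : Finset L | ∃ R, ConnectedOver Φ ∅ R ∧ (boundary Φ R).card ≤ m ∧
      R.biUnion f = A}, ∃ p : (Σ _ : Finset L, Finset V), p ∈ pairs ∧
        ∃ R, ConnectedOver Φ ∅ R ∧ R.biUnion f = A ∧ boundary Φ R = p.2 := by
    rintro A ⟨R₀, h1, h2, rfl⟩
    obtain ⟨Q, R, h3, h4, h5, h6⟩ := exists_important_region (f := f) hΦ h1 h2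
    refine ⟨⟨Q, boundary Φ R⟩, ?_, R, h5, h4, rfl⟩
    simp only [pairs, F, Finset.mem_sigma, Finset.mem_filter, Finset.mem_univ, true_and,
      Set.Finite.mem_toFinset]
    exact ⟨h3.trans hd, h6⟩
  choose! g hg1 hg2 using hex
  rw [← Set.ncard_coe_finset pairs]
  refine Set.ncard_le_ncard_of_injOn g hg1 ?_
  intro A hA A' hA' h
  obtain ⟨R, h1, h2, h3⟩ := hg2 A hA
  obtain ⟨R', h1', h2', h3'⟩ := hg2 A' hA'
  rw [← h2, ← h2', h1.eq_of_boundary_eq hΦ h1' (by rw [h3, h3', h])]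

end Boundary

/-! ### Cut characteristics -/

namespace LabeledGraph

/-- The label sets reachable from a single terminal. -/
theorem ncard_reachableLabels_le {V : Type*} {L : Type*} [Finite V] [Finite L]
    (G : LabeledGraph V L) (t : V) (m d : ℕ) (hd : 2 * m ≤ d) :
    {A : Set L | ∃ S : Finset V, S.card ≤ m ∧ G.reachableLabels t S = A}.ncard ≤
      (∑ j ∈ Finset.range (d + 1), (Nat.card L).choose j) * 4 ^ m := by
  classical
  have := Fintype.ofFinite V
  have := Fintype.ofFinite L
  let Φ : Finset V → Finset V := fun R =>
    insert t (Finset.univ.filter fun w => ∃ v ∈ R, G.graph.Adj v w)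
  have hΦ : ∀ A B, Φ (A ∪ B) = Φ A ∪ Φ B := fun A B => by
    ext w
    simp only [Φ, Finset.mem_insert, Finset.mem_union, Finset.mem_filter, Finset.mem_univ,
      true_and, or_and_right, exists_or]
    exact or_or_distrib_left
  rw [Nat.card_eq_fintype_card]
  refine le_trans ?_ (ncard_labelSets_le (f := fun v => (G.label v).toFinset) hΦ m d hd)
  refine (Set.ncard_le_ncard (t := (fun A : Finset L => (A : Set L)) '' _) ?_).trans
    Set.ncard_image_le
  rintro A ⟨S, hS, rfl⟩
  have hmem : ∀ {w}, w ∈ (G.reachableVertices t S).toFinset ↔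
      w ∈ G.reachableVertices t S := Set.mem_toFinset
  refine ⟨_, ⟨(G.reachableVertices t S).toFinset, ?_, ?_, rfl⟩, ?_⟩
  · intro U _ hU hdisj
    refine hU.antisymm fun w hw => ?_
    -- A boundary vertex of `U` is not reachable, so `U` is closed under steps avoiding `S`.
    have hcl : ∀ w ∈ Φ U, w ∈ G.reachableVertices t S → w ∈ U := fun w h1 h2 => by
      by_contra h3
      exact Finset.disjoint_left.1 hdisj (Finset.mem_sdiff.2 ⟨h1, h3⟩) (hmem.2 h2)
    obtain ⟨ht, hw', hreach⟩ := hmem.1 hw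
    have key : ∀ y : ((S : Set V)ᶜ : Set V),
        (G.graph.induce (S : Set V)ᶜ).Reachable ⟨t, ht⟩ y → (y : V) ∈ U := by
      intro y hy
      have hy' := (SimpleGraph.reachable_iff_reflTransGen _ _).1 hy
      induction hy' with
      | refl => exact hcl t (Finset.mem_insert_self _ _) ⟨ht, ht, SimpleGraph.Reachable.refl _⟩
      | @tail b c hb hbc ih =>
        have hb' := (SimpleGraph.reachable_iff_reflTransGen _ _).2 hb
        refine hcl c ?_ ⟨ht, c.2, hy⟩
        simp only [Φ, Finset.mem_insert, Finset.mem_filter, Finset.mem_univ, true_and]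
        exact Or.inr ⟨b, ih hb', hbc⟩
    exact key ⟨w, hw'⟩ hreach
  · refine (Finset.card_le_card ?_).trans hS
    intro w hw
    obtain ⟨h1, h2⟩ := Finset.mem_sdiff.1 hw
    by_contra hwS
    apply h2
    rw [hmem]
    simp only [Φ, Finset.mem_insert, Finset.mem_filter, Finset.mem_univ, true_and] at h1
    rcases h1 with rfl | ⟨v, hv, hvw⟩
    · exact ⟨hwS, hwS, SimpleGraph.Reachable.refl _⟩
    · obtain ⟨ht, hv', hreach⟩ := hmem.1 hv
      refine ⟨ht, hwS, hreach.trans (SimpleGraph.Adj.reachable ?_)⟩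
      exact hvw
  · ext l
    simp [reachableLabels]

theorem ncard_cutCharacteristics_le {V : Type*} {L : Type*} [Finite V] [Finite L]
    (G : LabeledGraph V L) {n : ℕ} (m d : ℕ) (T : Fin n ↪ V) (hd : 2 * m ≤ d) :
    (G.cutCharacteristics m T).ncard ≤
      ((∑ j ∈ Finset.range (d + 1), (Nat.card L).choose j) * 4 ^ m) ^ n := by
  classical
  let s : Fin n → Finset (Set L) := fun i =>
    (Set.toFinite {A : Set L | ∃ S : Finset V, S.card ≤ m ∧
      G.reachableLabels (T i) S = A}).toFinset
  have hsub : G.cutCharacteristics m T ⊆ (Fintype.piFinset s : Set (Fin n → Set L)) := by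
    rintro K ⟨S, hS, rfl⟩
    simp only [s, Finset.mem_coe, Fintype.mem_piFinset, Set.Finite.mem_toFinset]
    exact fun i => ⟨S, hS, rfl⟩
  refine (Set.ncard_le_ncard hsub (Finset.finite_toSet _)).trans ?_
  rw [Set.ncard_coe_finset, Fintype.card_piFinset]
  refine (Finset.prod_le_pow_card Finset.univ _ _ fun i _ => ?_).trans_eq
    (by rw [Finset.card_univ, Fintype.card_fin])
  rw [← Set.ncard_eq_toFinset_card]
  exact G.ncard_reachableLabels_le (T i) m d hd

/-- The bound by the number of all vectors of label sets. -/
theorem ncard_cutCharacteristics_le_two_pow {V : Type*} {L : Type*} [Finite L]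
    (G : LabeledGraph V L) {n : ℕ} (m : ℕ) (T : Fin n ↪ V) :
    (G.cutCharacteristics m T).ncard ≤ (2 ^ Nat.card L) ^ n := by
  classical
  have := Fintype.ofFinite L
  refine (Set.ncard_le_card _).trans (le_of_eq ?_)
  rw [Nat.card_eq_fintype_card, Nat.card_eq_fintype_card, Fintype.card_fun, Fintype.card_set,
    Fintype.card_fin]

end LabeledGraph

/-! ### Numerical estimates -/

theorem sum_Icc_add_one_mul_two (m : ℕ) :
    (∑ i ∈ Finset.Icc 1 m, (i + 1)) * 2 = m * (m + 3) := by
  induction m with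
  | zero => simp
  | succ m ih =>
    rw [Finset.sum_Icc_succ_top (by omega), add_mul, ih]
    ring

theorem two_mul_le_sum_Icc_add_one {m : ℕ} (hm : 1 ≤ m) :
    2 * m ≤ ∑ i ∈ Finset.Icc 1 m, (i + 1) := by
  have := sum_Icc_add_one_mul_two m
  nlinarith

theorem sum_choose_le_pow {r d : ℕ} (hr : 2 ≤ r) (hd : 2 ≤ d) :
    ∑ j ∈ Finset.range (d + 1), r.choose j ≤ r ^ d := by
  induction d, hd using Nat.le_induction with
  | base =>
    have h := Nat.choose_two_right r
    have h' := Nat.div_mul_le_self (r * (r - 1)) 2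
    rw [← h] at h'
    obtain ⟨s, rfl⟩ : ∃ s, r = s + 2 := ⟨r - 2, by omega⟩
    simp only [Finset.sum_range_succ, Finset.sum_range_zero, Nat.choose_zero_right,
      Nat.choose_one_right]
    have h2 : s + 2 - 1 = s + 1 := rfl
    rw [h2] at h'
    nlinarith
  | succ d hd ih =>
    rw [Finset.sum_range_succ]
    have h1 : r.choose (d + 1) ≤ r ^ d * (r - 1) := by
      have h2 := Nat.choose_succ_right_eq r d
      calc r.choose (d + 1) ≤ r.choose (d + 1) * (d + 1) := Nat.le_mul_of_pos_right _ (by omega)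
        _ = r.choose d * (r - d) := h2
        _ ≤ r ^ d * (r - 1) := Nat.mul_le_mul (Nat.choose_le_pow r d) (by omega)
    calc _ ≤ r ^ d + r ^ d * (r - 1) := add_le_add ih h1
      _ = r ^ d * (r - 1 + 1) := by ring
      _ = r ^ (d + 1) := by rw [Nat.sub_add_cancel (by omega), pow_succ]

theorem cutCharacteristicCounts_le {n m r k : ℕ} (hm : 1 ≤ m)
    (hk : k ∈ cutCharacteristicCounts n m r) :
    k ≤ ((∑ j ∈ Finset.range ((∑ i ∈ Finset.Icc 1 m, (i + 1)) + 1), r.choose j) * 4 ^ m) ^ n := by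
  obtain ⟨V, L, _, _, G, T, hr, rfl⟩ := hk
  refine (G.ncard_cutCharacteristics_le m _ T (two_mul_le_sum_Icc_add_one hm)).trans ?_
  gcongr

theorem isGreatest_cutCharacteristicMax {n m r : ℕ} (hm : 1 ≤ m) :
    IsGreatest (cutCharacteristicCounts n m r) (cutCharacteristicMax n m r) := by
  have hb : BddAbove (cutCharacteristicCounts n m r) :=
    ⟨_, fun _ hk => cutCharacteristicCounts_le hm hk⟩
  have hne : (cutCharacteristicCounts n m r).Nonempty :=
    ⟨_, Fin n, Fin 0, inferInstance, inferInstance, ⟨⊥, fun _ => ∅⟩, Function.Embedding.refl _,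
      by simp, rfl⟩
  exact ⟨Nat.sSup_mem hne hb, fun _ hk => le_csSup hb hk⟩

theorem cutCharacteristicMax_le {n m r : ℕ} (hm : 1 ≤ m) (hr : 1 ≤ r) :
    cutCharacteristicMax n m r ≤ m ^ (2 * n) * r ^ (n * m * (m + 3) / 2) * 4 ^ (n * m) := by
  have hmem := (isGreatest_cutCharacteristicMax (n := n) (r := r) hm).1
  have hexp : n * m * (m + 3) / 2 = (∑ i ∈ Finset.Icc 1 m, (i + 1)) * n := by
    have h := sum_Icc_add_one_mul_two m
    have h' : n * m * (m + 3) = (∑ i ∈ Finset.Icc 1 m, (i + 1)) * n * 2 := by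
      rw [mul_assoc n, ← h]
      ring
    rw [h', Nat.mul_div_cancel _ two_pos]
  have hone : 1 ≤ m ^ (2 * n) := Nat.one_le_pow _ _ hm
  suffices h : cutCharacteristicMax n m r ≤ r ^ (n * m * (m + 3) / 2) * 4 ^ (n * m) by
    rw [mul_assoc]
    exact h.trans (Nat.le_mul_of_pos_left _ hone)
  rcases hr.eq_or_lt with rfl | hr
  · -- For a single label the binomial sum is `2`, which `r ^ d = 1` does not absorb.
    obtain ⟨V, L, _, _, G, T, hL, hk⟩ := hmem
    rw [hk, one_pow, one_mul]
    calc _ ≤ (2 ^ Nat.card L) ^ n := G.ncard_cutCharacteristics_le_two_pow m T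
      _ ≤ (4 ^ m) ^ n := by
        apply Nat.pow_le_pow_left
        calc 2 ^ Nat.card L ≤ 2 ^ 1 := Nat.pow_le_pow_right two_pos hL
          _ ≤ 4 ^ 1 := by norm_num
          _ ≤ 4 ^ m := Nat.pow_le_pow_right (by norm_num) hm
      _ = 4 ^ (n * m) := by rw [← pow_mul, mul_comm]
  · refine (cutCharacteristicCounts_le hm hmem).trans ?_
    rw [hexp, mul_pow, ← pow_mul, mul_comm m n, pow_mul r]
    gcongr
    have := two_mul_le_sum_Icc_add_one hm
    exact sum_choose_le_pow hr (by omega)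

theorem cutCharacteristicMax_le_eval (n m r : ℕ) (hm : 1 ≤ m) :
    cutCharacteristicMax n m r ≤
      (((∑ j ∈ Finset.range ((∑ i ∈ Finset.Icc 1 m, (i + 1)) + 1), Polynomial.X ^ j) *
        Polynomial.C (4 ^ m)) ^ n : Polynomial ℕ).eval r := by
  refine (cutCharacteristicCounts_le hm (isGreatest_cutCharacteristicMax hm).1).trans ?_
  simp only [Polynomial.eval_pow, Polynomial.eval_mul, Polynomial.eval_C,
    Polynomial.eval_finsetSum, Polynomial.eval_X]
  gcongr
  exact Nat.choose_le_pow _ _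

theorem mainTheorem2 :
    -- explicit bound for every finite labeled graph with `n` distinct terminals
    (∀ (V : Type u) (L : Type v) [Finite V] [Finite L] (G : LabeledGraph V L) (n m : ℕ)
      (T : Fin n ↪ V), 1 ≤ m →
      (G.cutCharacteristics m T).ncard ≤
        ((∑ j ∈ Finset.range ((∑ i ∈ Finset.Icc 1 m, (i + 1)) + 1), (Nat.card L).choose j)
          * 4 ^ m) ^ n) ∧
    -- the maximum defining `κ(n, m, r)` is attained
    (∀ n m r : ℕ, 1 ≤ m → IsGreatest (cutCharacteristicCounts n m r)
      (cutCharacteristicMax n m r)) ∧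
    -- the asymptotic bound, with an absolute constant
    (∃ C : ℝ, ∀ n m r : ℕ, 1 ≤ m → 1 ≤ r →
      (cutCharacteristicMax n m r : ℝ) ≤
        C * ((m : ℝ) ^ (2 * n) * (r : ℝ) ^ (n * m * (m + 3) / 2) * (4 : ℝ) ^ (n * m))) ∧
    -- for fixed `n` and `m` it is bounded by a polynomial in `r`
    (∀ n m : ℕ, 1 ≤ m → ∃ p : Polynomial ℕ, ∀ r : ℕ, cutCharacteristicMax n m r ≤ p.eval r) := by
  refine ⟨?_, fun n m r hm => isGreatest_cutCharacteristicMax hm, ⟨1, fun n m r hm hr => ?_⟩,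
    fun n m hm => ⟨_, fun r => cutCharacteristicMax_le_eval n m r hm⟩⟩
  · intro V L _ _ G n m T hm
    exact G.ncard_cutCharacteristics_le m _ T (two_mul_le_sum_Icc_add_one hm)
  · rw [one_mul]
    exact_mod_cast cutCharacteristicMax_le hm hr
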